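/- Let $d\ge 2$. For a lattice $\Lambda\subset\mathbb R^d$ let $\Lambda^*=\{y\in\mathbb R^d:\langle y,x\rangle\in\mathbb Z\text{ for each }x\in\Lambda\}$ be its dual lattice. For $\tau=(\tau_1,\dots,\tau_d)\in\mathbb R^d$ with $\tau_1+\dots+\tau_d=0$ put $\mathcal B_\tau=\{x\in\mathbb R^d:|x_i|\le e^{\tau_i},\ i=1,\dots,d\}$. For $1\le k\le d$ let $\lambda_k(\mathcal B_\tau,\Lambda)$ be the $k$-th successive minimum, i.e. the infimum of positive $\lambda$ such that $\lambda\mathcal B_\tau$ contains at least $k$ linearly independent vectors of $\Lambda$, and let $L_k(\tau,\Lambda)=\log\lambda_k(\mathcal B_\tau,\Lambda)$, $S_k(\tau,\Lambda)=\sum_{1\le j\le k}L_j(\tau,\Lambda)$. Then there is a constant $C$, depending only on $d$, such that for every lattice $\Lambda\subset\mathbb R^d$ of covolume $1$ and every $\tau\in\mathbb R^d$ with $\tau_1+\dots+\tau_d=0$, $$S_1(\tau,\Lambda)\le\frac{S_1(-\tau,\Lambda^*)}{d-1}+C.$$ -/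

import Mathlib

open scoped Pointwise Matrix

noncomputable section

/-- The dual of a lattice `Λ` in `ℝ^d` with respect to the standard inner product:
all `y` with `⟨y, x⟩ ∈ ℤ` for each `x ∈ Λ`. -/
def dualLattice {d : ℕ} (Λ : Submodule ℤ (Fin d → ℝ)) : Submodule ℤ (Fin d → ℝ) :=
  LinearMap.BilinForm.dualSubmodule (dotProductBilin ℝ ℝ) Λ

theorem mem_dualLattice {d : ℕ} {Λ : Submodule ℤ (Fin d → ℝ)} {y : Fin d → ℝ} :
    y ∈ dualLattice Λ ↔ ∀ x ∈ Λ, ∃ n : ℤ, (n : ℝ) = y ⬝ᵥ x := by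
  simp [dualLattice, LinearMap.BilinForm.mem_dualSubmodule, Submodule.mem_one]

/-- The box `D_τ 𝓑`, where `𝓑` is the closed unit ball of the sup-norm on `ℝ^d` (the norm of the
type `Fin d → ℝ`) and `D_τ = diag(e^{τ_1}, …, e^{τ_d})`. -/
def box {d : ℕ} (τ : Fin d → ℝ) : Set (Fin d → ℝ) :=
  (fun x => Matrix.diagonal (fun i => Real.exp (τ i)) *ᵥ x) '' Metric.closedBall 0 1

theorem mem_box {d : ℕ} {τ x : Fin d → ℝ} :
    x ∈ box τ ↔ ∀ i, |x i| ≤ Real.exp (τ i) := by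
  simp only [box, Set.mem_image, mem_closedBall_zero_iff]
  constructor
  · rintro ⟨y, hy, rfl⟩ i
    have h : |y i| ≤ 1 := (norm_le_pi_norm y i).trans hy
    rw [Matrix.mulVec_diagonal, abs_mul, Real.abs_exp]
    exact mul_le_of_le_one_right (Real.exp_pos _).le h
  · intro h
    refine ⟨fun i => Real.exp (-τ i) * x i, ?_, ?_⟩
    · refine (pi_norm_le_iff_of_nonneg zero_le_one).2 fun i => ?_
      rw [Real.norm_eq_abs, abs_mul, Real.abs_exp, Real.exp_neg, inv_mul_le_iff₀ (Real.exp_pos _),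
        mul_one]
      exact h i
    · ext i
      rw [Matrix.mulVec_diagonal, ← mul_assoc, ← Real.exp_add, add_neg_cancel, Real.exp_zero,
        one_mul]

/-- The `k`-th successive minimum of a set `M` with respect to `Λ`: the infimum of positive `r`
such that `r • M` contains at least `k` linearly independent vectors of `Λ`. -/
def successiveMin {d : ℕ} (k : ℕ) (M : Set (Fin d → ℝ)) (Λ : Submodule ℤ (Fin d → ℝ)) : ℝ :=
  sInf {r : ℝ | 0 < r ∧ ∃ v : Fin k → (Fin d → ℝ),
    (∀ i, v i ∈ Λ ∧ v i ∈ r • M) ∧ LinearIndependent ℝ v}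

/-- `L_k(τ, Λ) = log λ_k(𝓑_τ, Λ)`. -/
def logMin {d : ℕ} (k : ℕ) (τ : Fin d → ℝ) (Λ : Submodule ℤ (Fin d → ℝ)) : ℝ :=
  Real.log (successiveMin k (box τ) Λ)

/-- `S_k(τ, Λ) = L_1(τ, Λ) + ⋯ + L_k(τ, Λ)`. -/
def logMinSum {d : ℕ} (k : ℕ) (τ : Fin d → ℝ) (Λ : Submodule ℤ (Fin d → ℝ)) : ℝ :=
  ∑ j ∈ Finset.Icc 1 k, logMin j τ Λ

end

/-!
Let `v ∈ Λ*` be nonzero with `|v j| * exp (τ j) ≤ r` for all `j`, and let `i` maximise the left-hand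
side. Minkowski's linear forms theorem, applied to the form `x ↦ ⟨v, x⟩` with bound `1` and to the
coordinates `x j`, `j ≠ i`, with bounds `R * exp (τ j)`, produces a nonzero `x ∈ Λ`. Since `⟨v, x⟩`
is an integer of absolute value less than `1`, it vanishes, so `x i` is a combination of the other
coordinates and is at most `(d - 1) * R * exp (τ i)` by maximality of `i`. The volume condition is
`r * covol Λ * exp (-∑ τ) < R ^ (d - 1)`, which accounts for the exponent `1 / (d - 1)`.
-/

section Minkowski

open MeasureTheory Module

theorem exists_mem_ne_zero_of_covolume_mul_two_pow_lt_measure {E : Type*} [NormedAddCommGroup E]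
    [NormedSpace ℝ E] [FiniteDimensional ℝ E] [MeasurableSpace E] [BorelSpace E]
    (Λ : Submodule ℤ E) [DiscreteTopology Λ] [IsZLattice ℝ Λ] (μ : Measure E) [μ.IsAddHaarMeasure]
    {s : Set E} (h_symm : ∀ x ∈ s, -x ∈ s) (h_conv : Convex ℝ s)
    (h : ENNReal.ofReal (ZLattice.covolume Λ μ) * 2 ^ finrank ℝ E < μ s) :
    ∃ x ∈ Λ, x ≠ 0 ∧ x ∈ s := by
  let b := Free.chooseBasis ℤ Λ
  have fund : IsAddFundamentalDomain Λ.toAddSubgroup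
      (ZSpan.fundamentalDomain (b.ofZLatticeBasis ℝ)) μ := ZLattice.isAddFundamentalDomain b μ
  have hcov : ENNReal.ofReal (ZLattice.covolume Λ μ) =
      μ (ZSpan.fundamentalDomain (b.ofZLatticeBasis ℝ)) := by
    rw [ZLattice.covolume_eq_measure_fundamentalDomain Λ μ fund, Measure.real,
      ENNReal.ofReal_toReal (ZSpan.fundamentalDomain_isBounded _).measure_lt_top.ne]
  have : Countable Λ.toAddSubgroup := inferInstanceAs (Countable Λ)
  obtain ⟨x, hx0, hxs⟩ :=
    exists_ne_zero_mem_lattice_of_measure_mul_two_pow_lt_measure fund h_symm h_conv (hcov ▸ h)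
  exact ⟨x, x.2, Subtype.coe_ne_coe.2 hx0, hxs⟩

variable {ι : Type*} [Fintype ι] [DecidableEq ι]

theorem setOf_forall_abs_mulVec_lt (A : Matrix ι ι ℝ) (c : ι → ℝ) :
    {x : ι → ℝ | ∀ i, |(A *ᵥ x) i| < c i} =
      Matrix.toLin' A ⁻¹' Set.univ.pi fun i => Metric.ball (0 : ℝ) (c i) := by
  ext x
  simp only [Set.mem_ofPred_eq, Set.mem_preimage, Matrix.toLin'_apply, Set.mem_univ_pi,
    mem_ball_zero_iff, Real.norm_eq_abs]

theorem volume_setOf_forall_abs_mulVec_lt {A : Matrix ι ι ℝ} (hA : A.det ≠ 0) {c : ι → ℝ}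
    (hc : ∀ i, 0 < c i) :
    volume {x : ι → ℝ | ∀ i, |(A *ᵥ x) i| < c i} =
      ENNReal.ofReal (|A.det|⁻¹ * (2 ^ Fintype.card ι * ∏ i, c i)) := by
  have hbox : volume (Set.univ.pi fun i => Metric.ball (0 : ℝ) (c i)) =
      ENNReal.ofReal (2 ^ Fintype.card ι * ∏ i, c i) := by
    simp only [volume_pi_pi, Real.volume_ball]
    rw [← ENNReal.ofReal_prod_of_nonneg fun i _ => mul_nonneg zero_le_two (hc i).le,
      Finset.prod_mul_distrib, Finset.prod_const, Finset.card_univ]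
  rw [setOf_forall_abs_mulVec_lt, Measure.addHaar_preimage_linearMap _
    (by rwa [LinearMap.det_toLin']), hbox, LinearMap.det_toLin', abs_inv,
    ENNReal.ofReal_mul (inv_nonneg.2 (abs_nonneg _))]

theorem exists_mem_ne_zero_forall_abs_mulVec_lt (Λ : Submodule ℤ (ι → ℝ)) [DiscreteTopology Λ]
    [IsZLattice ℝ Λ] {A : Matrix ι ι ℝ} (hA : A.det ≠ 0) {c : ι → ℝ} (hc : ∀ i, 0 < c i)
    (h : |A.det| * ZLattice.covolume Λ < ∏ i, c i) :
    ∃ x ∈ Λ, x ≠ 0 ∧ ∀ i, |(A *ᵥ x) i| < c i := by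
  refine exists_mem_ne_zero_of_covolume_mul_two_pow_lt_measure Λ volume
    (s := {x | ∀ i, |(A *ᵥ x) i| < c i}) (fun x hx i => ?_) ?_ ?_
  · rw [Matrix.mulVec_neg, Pi.neg_apply, abs_neg]
    exact hx i
  · rw [setOf_forall_abs_mulVec_lt]
    exact (convex_pi fun i _ => convex_ball 0 (c i)).linear_preimage _
  · have hcov : 0 < ZLattice.covolume Λ := ZLattice.covolume_pos Λ
    have hdet : 0 < |A.det| := abs_pos.2 hA
    have hprod : 0 < ∏ i, c i := Finset.prod_pos fun i _ => hc i
    rw [volume_setOf_forall_abs_mulVec_lt hA hc, finrank_fintype_fun_eq_card,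
      ← ENNReal.ofReal_ofNat 2, ← ENNReal.ofReal_pow zero_le_two,
      ← ENNReal.ofReal_mul hcov.le, ENNReal.ofReal_lt_ofReal_iff (by positivity),
      lt_inv_mul_iff₀ hdet, ← mul_assoc, mul_comm (2 ^ _)]
    gcongr

theorem det_one_updateRow {R : Type*} [CommRing R] (i : ι) (v : ι → R) :
    ((1 : Matrix ι ι R).updateRow i v).det = v i := by
  rw [← Matrix.cramer_transpose_apply, Matrix.transpose_one, Matrix.cramer_one,
    Module.End.one_apply]

end Minkowski

theorem lattice_ne_bot (K : Type*) {E : Type*} [NormedField K] [NormedAddCommGroup E]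
    [NormedSpace K E] [Nontrivial E] (Λ : Submodule ℤ E) [DiscreteTopology Λ] [IsZLattice K Λ] :
    Λ ≠ ⊥ := by
  rintro rfl
  have h := IsZLattice.span_top (K := K) (L := (⊥ : Submodule ℤ E))
  rw [Submodule.bot_coe, Submodule.span_zero_singleton] at h
  exact bot_ne_top h

theorem abs_le_of_dotProduct_eq_zero {ι : Type*} [Fintype ι] {v x w : ι → ℝ} {R : ℝ} {i : ι}
    (hvx : v ⬝ᵥ x = 0) (hvi : v i ≠ 0) (hmax : ∀ k, |v k| * w k ≤ |v i| * w i) (hR : 0 ≤ R)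
    (hx : ∀ k ≠ i, |x k| ≤ R * w k) :
    |x i| ≤ (Fintype.card ι - 1 : ℕ) * R * w i := by
  classical
  have hxi : v i * x i = -∑ k ∈ Finset.univ.erase i, v k * x k := by
    rw [eq_neg_iff_add_eq_zero, Finset.add_sum_erase _ (fun k => v k * x k) (Finset.mem_univ i)]
    exact hvx
  refine le_of_mul_le_mul_left ?_ (abs_pos.2 hvi)
  calc |v i| * |x i| = |∑ k ∈ Finset.univ.erase i, v k * x k| := by rw [← abs_mul, hxi, abs_neg]
    _ ≤ ∑ k ∈ Finset.univ.erase i, |v k * x k| := Finset.abs_sum_le_sum_abs _ _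
    _ ≤ ∑ _ ∈ Finset.univ.erase i, R * (|v i| * w i) := Finset.sum_le_sum fun k hk =>
        calc |v k * x k| = |v k| * |x k| := abs_mul _ _
          _ ≤ |v k| * (R * w k) := by gcongr; exact hx k (Finset.ne_of_mem_erase hk)
          _ = R * (|v k| * w k) := by ring
          _ ≤ R * (|v i| * w i) := mul_le_mul_of_nonneg_left (hmax k) hR
    _ = |v i| * ((Fintype.card ι - 1 : ℕ) * R * w i) := by
        rw [Finset.sum_const, Finset.card_erase_of_mem (Finset.mem_univ i), Finset.card_univ,
          nsmul_eq_mul]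
        ring

theorem prod_erase_mul_exp {ι : Type*} [Fintype ι] [DecidableEq ι] (R : ℝ) (τ : ι → ℝ) (i : ι) :
    ∏ j ∈ Finset.univ.erase i, R * Real.exp (τ j) =
      R ^ (Fintype.card ι - 1) * Real.exp (∑ j, τ j - τ i) := by
  rw [Finset.prod_mul_distrib, Finset.prod_const, Finset.card_erase_of_mem (Finset.mem_univ i),
    Finset.card_univ, ← Real.exp_sum, Finset.sum_erase_eq_sub (Finset.mem_univ i)]

section FirstMinimum

variable {d : ℕ} {M : Set (Fin d → ℝ)} {Λ : Submodule ℤ (Fin d → ℝ)}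

theorem successiveMin_one (M : Set (Fin d → ℝ)) (Λ : Submodule ℤ (Fin d → ℝ)) :
    successiveMin 1 M Λ = sInf {r : ℝ | 0 < r ∧ ∃ x ∈ Λ, x ≠ 0 ∧ x ∈ r • M} := by
  unfold successiveMin
  congr 1
  ext r
  refine and_congr_right fun _ => ⟨?_, ?_⟩
  · rintro ⟨v, hv, hli⟩
    exact ⟨v 0, (hv 0).1, hli.ne_zero 0, (hv 0).2⟩
  · rintro ⟨x, hxΛ, hx0, hxM⟩
    exact ⟨fun _ => x, fun _ => ⟨hxΛ, hxM⟩, .of_subsingleton 0 hx0⟩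

theorem successiveMin_one_le {x : Fin d → ℝ} {r : ℝ} (hr : 0 < r) (hx : x ∈ Λ) (hx0 : x ≠ 0)
    (hxM : x ∈ r • M) : successiveMin 1 M Λ ≤ r := by
  rw [successiveMin_one]
  exact csInf_le ⟨0, fun _ hs => hs.1.le⟩ ⟨hr, x, hx, hx0, hxM⟩

theorem le_successiveMin_one {a : ℝ} (hM : Absorbent ℝ M) (hΛ : Λ ≠ ⊥)
    (h : ∀ r > 0, ∀ x ∈ Λ, x ≠ 0 → x ∈ r • M → a ≤ r) : a ≤ successiveMin 1 M Λ := by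
  rw [successiveMin_one]
  obtain ⟨x, hx, hx0⟩ := Λ.exists_mem_ne_zero_of_ne_bot hΛ
  obtain ⟨r, hr, hrx⟩ := (hM x).exists_pos
  have hxr : x ∈ r • M := hrx r (Real.le_norm_self r) rfl
  exact le_csInf ⟨r, hr, x, hx, hx0, hxr⟩ fun s ⟨hs, y, hy, hy0, hyM⟩ => h s hs y hy hy0 hyM

theorem successiveMin_one_pos [DiscreteTopology Λ] (hM : Absorbent ℝ M)
    (hMb : Bornology.IsBounded M) (hΛ : Λ ≠ ⊥) : 0 < successiveMin 1 M Λ := by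
  obtain ⟨ε, hε, hball⟩ := Metric.exists_ball_inter_eq_singleton_of_mem_discrete
    (s := (Λ : Set (Fin d → ℝ))) ⟨‹_›⟩ Λ.zero_mem
  obtain ⟨C, hC, hMC⟩ := hMb.exists_pos_norm_le
  have hε_le {x : Fin d → ℝ} (hx : x ∈ Λ) (hx0 : x ≠ 0) : ε ≤ ‖x‖ := by
    by_contra! hlt
    exact hx0 (Set.mem_singleton_iff.1 (hball ▸ ⟨mem_ball_zero_iff.2 hlt, hx⟩))
  refine (div_pos hε hC).trans_le (le_successiveMin_one hM hΛ fun r hr x hx hx0 hxM => ?_)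
  obtain ⟨y, hy, rfl⟩ := hxM
  rw [div_le_iff₀ hC]
  calc ε ≤ ‖r • y‖ := hε_le hx hx0
    _ = r * ‖y‖ := by rw [norm_smul, Real.norm_of_nonneg hr.le]
    _ ≤ r * C := by gcongr; exact hMC y hy

end FirstMinimum

section Box

variable {d : ℕ}

theorem mem_smul_box {τ x : Fin d → ℝ} {r : ℝ} (hr : 0 < r) :
    x ∈ r • box τ ↔ ∀ i, |x i| ≤ r * Real.exp (τ i) := by
  rw [Set.mem_smul_set_iff_inv_smul_mem₀ hr.ne', mem_box]
  refine forall_congr' fun i => ?_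
  rw [Pi.smul_apply, smul_eq_mul, abs_mul, abs_of_pos (inv_pos.2 hr), inv_mul_le_iff₀ hr]

theorem absorbent_box (τ : Fin d → ℝ) : Absorbent ℝ (box τ) := by
  refine absorbent_nhds_zero ?_
  have hcoord (i : Fin d) : ∀ᶠ x : Fin d → ℝ in nhds 0, |x i| ≤ Real.exp (τ i) :=
    (continuous_apply i).abs.continuousAt.eventually_le_const (by simpa using Real.exp_pos (τ i))
  filter_upwards [Filter.eventually_all.2 hcoord] with x hx
  exact mem_box.2 hx

theorem isBounded_box (τ : Fin d → ℝ) : Bornology.IsBounded (box τ) :=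
  ((isCompact_closedBall 0 1).image (continuous_const.matrix_mulVec continuous_id)).isBounded

end Box

section Duality

variable {d : ℕ}

theorem dotProduct_eq_zero_of_mem_dualLattice {Λ : Submodule ℤ (Fin d → ℝ)} {v x : Fin d → ℝ}
    (hv : v ∈ dualLattice Λ) (hx : x ∈ Λ) (h : |v ⬝ᵥ x| < 1) : v ⬝ᵥ x = 0 := by
  obtain ⟨n, hn⟩ := mem_dualLattice.1 hv x hx
  have hn1 : |n| < 1 := by
    rw [← hn] at h
    exact_mod_cast h
  rw [← hn, Int.abs_lt_one_iff.1 hn1, Int.cast_zero]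

variable (Λ : Submodule ℤ (Fin d → ℝ)) [DiscreteTopology Λ] [IsZLattice ℝ Λ]

theorem successiveMin_one_box_pos [NeZero d] (τ : Fin d → ℝ) : 0 < successiveMin 1 (box τ) Λ :=
  successiveMin_one_pos (absorbent_box τ) (isBounded_box τ) (lattice_ne_bot ℝ Λ)

theorem dualLattice_ne_bot [NeZero d] : dualLattice Λ ≠ ⊥ := by
  let b := Module.Free.chooseBasis ℤ Λ
  let B := b.ofZLatticeBasis ℝ
  obtain ⟨i⟩ : Nonempty (Module.Free.ChooseBasisIndex ℤ Λ) := B.index_nonempty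
  obtain ⟨y, hy⟩ := (dotProductEquiv ℝ (Fin d)).surjective (B.coord i)
  have hyx (x : Fin d → ℝ) : y ⬝ᵥ x = B.coord i x := DFunLike.congr_fun hy x
  refine (Submodule.ne_bot_iff _).2 ⟨y, mem_dualLattice.2 fun x hx => ⟨b.repr ⟨x, hx⟩ i, ?_⟩, ?_⟩
  · rw [hyx, Module.Basis.coord_apply]
    exact (b.ofZLatticeBasis_repr_apply ℝ Λ ⟨x, hx⟩ i).symm
  · rintro rfl
    simpa using hyx (B i)

theorem exists_mem_ne_zero_dotProduct_eq_zero {v c : Fin d → ℝ} {i : Fin d}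
    (hv : v ∈ dualLattice Λ) (hvi : v i ≠ 0) (hc : ∀ j ≠ i, 0 < c j)
    (h : |v i| * ZLattice.covolume Λ < ∏ j ∈ Finset.univ.erase i, c j) :
    ∃ x ∈ Λ, x ≠ 0 ∧ v ⬝ᵥ x = 0 ∧ ∀ j ≠ i, |x j| < c j := by
  set A := (1 : Matrix (Fin d) (Fin d) ℝ).updateRow i v with hA
  have hdet : A.det = v i := det_one_updateRow i v
  have hpos (j : Fin d) : 0 < Function.update c i 1 j := by
    rcases eq_or_ne j i with rfl | hj <;> simp [*]
  have hprod : ∏ j, Function.update c i 1 j = ∏ j ∈ Finset.univ.erase i, c j := by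
    rw [Finset.prod_update_of_mem (Finset.mem_univ i), one_mul, Finset.sdiff_singleton_eq_erase]
  obtain ⟨x, hx, hx0, hAx⟩ := exists_mem_ne_zero_forall_abs_mulVec_lt Λ (hdet ▸ hvi) hpos
    (by rwa [hdet, hprod])
  refine ⟨x, hx, hx0, dotProduct_eq_zero_of_mem_dualLattice hv hx ?_, fun j hj => ?_⟩
  · simpa [hA, Matrix.mulVec] using hAx i
  · simpa [hA, Matrix.mulVec, Matrix.updateRow_ne hj, Function.update_of_ne hj, dotProduct,
      Matrix.one_apply] using hAx j

theorem successiveMin_one_box_le_of_mem_dualLattice (hd : 2 ≤ d) {τ v : Fin d → ℝ}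
    (hv : v ∈ dualLattice Λ) (hv0 : v ≠ 0) {r R : ℝ} (hr : 0 < r) (hvr : v ∈ r • box (-τ))
    (hR : 0 < R) (hrR : r * (ZLattice.covolume Λ * Real.exp (-∑ i, τ i)) < R ^ (d - 1)) :
    successiveMin 1 (box τ) Λ ≤ (d - 1 : ℕ) * R := by
  have : NeZero d := ⟨by lia⟩
  obtain ⟨i, hmax⟩ := Finite.exists_max fun j => |v j| * Real.exp (τ j)
  have hvi : v i ≠ 0 := by
    obtain ⟨j, hj⟩ := Function.ne_iff.1 hv0
    have hji := (mul_pos (abs_pos.2 hj) (Real.exp_pos (τ j))).trans_le (hmax j)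
    exact abs_pos.1 (pos_of_mul_pos_left hji (Real.exp_pos _).le)
  have hvol : |v i| * ZLattice.covolume Λ < ∏ j ∈ Finset.univ.erase i, R * Real.exp (τ j) := by
    have hcov : 0 < ZLattice.covolume Λ := ZLattice.covolume_pos Λ
    calc |v i| * ZLattice.covolume Λ ≤ r * Real.exp (-τ i) * ZLattice.covolume Λ := by
          gcongr
          exact (mem_smul_box hr).1 hvr i
      _ = r * (ZLattice.covolume Λ * Real.exp (-∑ j, τ j)) * Real.exp (∑ j, τ j - τ i) := by
          rw [sub_eq_add_neg, Real.exp_add, Real.exp_neg (∑ j, τ j)]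
          field_simp
      _ < R ^ (d - 1) * Real.exp (∑ j, τ j - τ i) := by gcongr
      _ = ∏ j ∈ Finset.univ.erase i, R * Real.exp (τ j) := by
          rw [prod_erase_mul_exp, Fintype.card_fin]
  obtain ⟨x, hx, hx0, hvx, hxj⟩ := exists_mem_ne_zero_dotProduct_eq_zero Λ hv hvi
    (fun j _ => mul_pos hR (Real.exp_pos (τ j))) hvol
  have hxi := abs_le_of_dotProduct_eq_zero hvx hvi hmax hR.le fun j hj => (hxj j hj).le
  have hd1 : (1 : ℝ) ≤ (d - 1 : ℕ) := by exact_mod_cast (by lia : 1 ≤ d - 1)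
  have hdR : 0 < (d - 1 : ℕ) * R := by positivity
  refine successiveMin_one_le hdR hx hx0 ((mem_smul_box hdR).2 fun j => ?_)
  rcases eq_or_ne j i with rfl | hj
  · simpa using hxi
  · refine (hxj j hj).le.trans ?_
    gcongr
    exact le_mul_of_one_le_left hR.le hd1

theorem successiveMin_one_box_div_pow_le (hd : 2 ≤ d) (τ : Fin d → ℝ) :
    (successiveMin 1 (box τ) Λ / (d - 1 : ℕ)) ^ (d - 1) ≤
      successiveMin 1 (box (-τ)) (dualLattice Λ) *
        (ZLattice.covolume Λ * Real.exp (-∑ i, τ i)) := by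
  have : NeZero d := ⟨by lia⟩
  have hd1 : (0 : ℝ) < (d - 1 : ℕ) := by exact_mod_cast (by lia : 0 < d - 1)
  have hK : 0 < ZLattice.covolume Λ * Real.exp (-∑ i, τ i) :=
    mul_pos (ZLattice.covolume_pos Λ) (Real.exp_pos _)
  have hpos := successiveMin_one_box_pos Λ τ
  rw [← div_le_iff₀ hK]
  refine le_successiveMin_one (absorbent_box _) (dualLattice_ne_bot Λ) fun r hr v hv hv0 hvr => ?_
  rw [div_le_iff₀ hK]
  by_contra! hlt
  obtain ⟨q, hq, hrq, hql⟩ := exists_rat_pow_btwn (by lia : d - 1 ≠ 0) hlt (by positivity)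
  have hq_lt := lt_of_pow_lt_pow_left₀ _ (by positivity) hql
  rw [lt_div_iff₀' hd1] at hq_lt
  exact hq_lt.not_ge
    (successiveMin_one_box_le_of_mem_dualLattice Λ hd hv hv0 hr hvr (Rat.cast_pos.2 hq) hrq)

end Duality

theorem theoremt_general {d : ℕ} (hd : 2 ≤ d) (Λ : Submodule ℤ (Fin d → ℝ)) [DiscreteTopology Λ]
    [IsZLattice ℝ Λ] (τ : Fin d → ℝ) :
    logMinSum 1 τ Λ ≤
      (logMinSum 1 (-τ) (dualLattice Λ) + Real.log (ZLattice.covolume Λ) - ∑ i, τ i) /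
        ((d : ℝ) - 1) + Real.log ((d : ℝ) - 1) := by
  have : NeZero d := ⟨by lia⟩
  have hcast : ((d - 1 : ℕ) : ℝ) = (d : ℝ) - 1 := Nat.cast_pred (by lia)
  have hd1 : 0 < (d : ℝ) - 1 := hcast ▸ Nat.cast_pos.2 (by lia)
  have hl := successiveMin_one_box_pos Λ τ
  have hcov : 0 < ZLattice.covolume Λ := ZLattice.covolume_pos Λ
  have hpow := successiveMin_one_box_div_pow_le Λ hd τ
  have hpow_pos : 0 < (successiveMin 1 (box τ) Λ / (d - 1 : ℕ)) ^ (d - 1) := by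
    rw [hcast]
    positivity
  have hm : 0 < successiveMin 1 (box (-τ)) (dualLattice Λ) :=
    pos_of_mul_pos_left (hpow_pos.trans_le hpow) (by positivity)
  have hlog := Real.log_le_log hpow_pos hpow
  rw [Real.log_pow, hcast, Real.log_div hl.ne' hd1.ne', Real.log_mul hm.ne' (by positivity),
    Real.log_mul hcov.ne' (Real.exp_ne_zero _), Real.log_exp] at hlog
  simp only [logMinSum, logMin, Finset.Icc_self, Finset.sum_singleton]
  rw [← sub_le_iff_le_add, le_div_iff₀' hd1]
  linarith

theorem theoremt (d : ℕ) (hd : 2 ≤ d) :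
    ∃ C : ℝ, ∀ (Λ : Submodule ℤ (Fin d → ℝ)) [DiscreteTopology Λ] [IsZLattice ℝ Λ],
      ZLattice.covolume Λ = 1 →
      ∀ τ : Fin d → ℝ, ∑ i, τ i = 0 →
        logMinSum 1 τ Λ ≤ logMinSum 1 (-τ) (dualLattice Λ) / ((d : ℝ) - 1) + C := by
  refine ⟨Real.log ((d : ℝ) - 1), fun Λ _ _ hΛ τ hτ => ?_⟩
  simpa only [hΛ, hτ, Real.log_one, add_zero, sub_zero] using theoremt_general hd Λ τ
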